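/- Let $\mathbb{F}$ be an algebraically closed field. For $i,j\in\mathbb{N}$ let $D_{ij}$ be the Hasse derivative on $\mathbb{F}[x,y]$, i.e. the $\mathbb{F}$-linear map with $D_{ij}x^ay^b=\binom{a}{i}\binom{b}{j}x^{a-i}y^{b-j}$ if $a\ge i$ and $b\ge j$, and $D_{ij}x^ay^b=0$ otherwise. Let $\mathcal{D}$ be the $\mathbb{F}$-vector space with basis $\{D_{ij}\}_{i,j\in\mathbb{N}}$, and let $A_x,A_y:\mathcal{D}\to\mathcal{D}$ be the linear maps with $A_x(D_{ij})=D_{i-1,j}$ if $i>0$ and $0$ otherwise, and $A_y(D_{ij})=D_{i,j-1}$ if $j>0$ and $0$ otherwise. A subspace $V\subset\mathcal{D}$ is closed if it is finite-dimensional, $A_x(V)\subset V$ and $A_y(V)\subset V$. The Möller indices with respect to $y$ of a closed subspace $V\neq\{0\}$ are the positive integers $\alpha(0),\dots,\alpha(\beta-1)$, where $\beta=1+\max\{i : D_{i0}\in V\}$ and $$\alpha(i)=1+\max\Big\{j : \exists\,\phi=D_{ij}+\sum_{(k,\ell)\ne(i,j),\ \ell\le j}c_{k\ell}D_{k\ell}\in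 V\Big\},\qquad i=0,\dots,\beta-1$$ (finite sums). For an ideal $I\subset\mathbb{F}[x,y]$ and a point $(x_0,y_0)$ of its zero set $\mathcal{V}(I)$, the Möller indices with respect to $y$ of $I$ at $(x_0,y_0)$ are those of the dual space $V_{(x_0,y_0)}=\{\phi\in\mathcal{D} : (\phi p)(x_0,y_0)=0\ \ \forall p\in I\}$, whenever this space is closed and nonzero. Let $f,g\in\mathbb{F}[x,y]$ have degrees $m$ and $n$ in $x$, and suppose that $\langle f,g\rangle$ is zero-dimensional, i.e. $\mathbb{F}[x,y]/\langle f,g\rangle$ is finite-dimensional over $\mathbb{F}$. Let $a,b,c,d\in\mathbb{F}$ satisfy $ad-bc=1$, $c\ne0$, and $cx_1\ne a$ for every $(x_1,y_1)\in\mathcal{V}(\langle f,g\rangle)$. Put $\phi(z)=\frac{az+b}{cz+d}$ and $$\hat f(z,y)=(cz+d)^m f(\phi(z),y),\qquad \hat g(z,y)=(cz+d)^n g(\phi(z),y)\qquad\text{in }\mathbb{F}[z,y].$$ Let $x_0,z_0,y_0\in\mathbb{F}$ with $cz_0+d\ne0$ and $x_0=\phi(z_0)$ (equivalently, $a-cx_0\neq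 0$ and $z_0=\phi^{-1}(x_0)=\frac{dx_0-b}{a-cx_0}$). Then $(x_0,y_0)\in\mathcal{V}(\langle f,g\rangle)$ if and only if $(z_0,y_0)\in\mathcal{V}(\langle\hat f,\hat g\rangle)$. In this case the Möller indices with respect to $y$ of $\langle f,g\rangle$ at $(x_0,y_0)$ and those of $\langle\hat f,\hat g\rangle$ at $(z_0,y_0)$ are well defined (both dual spaces are closed and nonzero), and they coincide: the two numbers $\beta$ are equal, and so are the two sequences $\alpha(0),\dots,\alpha(\beta-1)$. -/

import Mathlib

namespace Moller

noncomputable section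

/-- `F[x, y]`: the variable `x` (or `z`) is `X 0`, the variable `y` is `X 1`. -/
abbrev Poly₂ (F : Type*) [Field F] := MvPolynomial (Fin 2) F

/-- An ideal `I` of `F[x, y]` is zero-dimensional if `F[x, y] / I` is a finite-dimensional
vector space over `F`. -/
def IsZeroDimensional {F : Type*} [Field F] (I : Ideal (Poly₂ F)) : Prop :=
  Module.Finite F (Poly₂ F ⧸ I)

/-- The Hasse derivative `D_{ij}` on `F[x, y]`. -/
def hasse (F : Type*) [Field F] (i j : ℕ) : Module.End F (Poly₂ F) :=
  (MvPolynomial.basisMonomials (Fin 2) F).constr F fun e =>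
    if i ≤ e 0 ∧ j ≤ e 1 then
      MvPolynomial.C (((e 0).choose i : F) * ((e 1).choose j : F)) *
        MvPolynomial.X 0 ^ (e 0 - i) * MvPolynomial.X 1 ^ (e 1 - j)
    else 0

/-- `D_{ij}(x^a y^b)` is `(a choose i) (b choose j) x^(a-i) y^(b-j)` if `i ≤ a` and `j ≤ b`,
and `0` otherwise. -/
theorem hasse_X_pow_mul_X_pow (F : Type*) [Field F] (i j a b : ℕ) :
    hasse F i j (MvPolynomial.X 0 ^ a * MvPolynomial.X 1 ^ b) =
      if i ≤ a ∧ j ≤ b then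
        MvPolynomial.C ((a.choose i : F) * (b.choose j : F)) *
          MvPolynomial.X 0 ^ (a - i) * MvPolynomial.X 1 ^ (b - j)
      else 0 := by
  have h : (MvPolynomial.X 0 ^ a * MvPolynomial.X 1 ^ b : Poly₂ F) =
      MvPolynomial.basisMonomials (Fin 2) F (Finsupp.single 0 a + Finsupp.single 1 b) := by
    simp [MvPolynomial.X_pow_eq_monomial, MvPolynomial.monomial_mul]
  rw [h, hasse, Module.Basis.constr_basis]
  simp

/-- The Hasse derivatives are linearly independent over `F`. -/
theorem linearIndependent_hasse (F : Type*) [Field F] :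
    LinearIndependent F fun p : ℕ × ℕ => hasse F p.1 p.2 := by
  rw [linearIndependent_iff]
  intro c hc
  ext ⟨a, b⟩
  have h := congrArg (fun L : Module.End F (Poly₂ F) =>
    MvPolynomial.constantCoeff (L (MvPolynomial.X 0 ^ a * MvPolynomial.X 1 ^ b))) hc
  simp only [Finsupp.linearCombination_apply, Finsupp.sum, LinearMap.sum_apply,
    LinearMap.smul_apply, map_sum, LinearMap.zero_apply, map_zero,
    hasse_X_pow_mul_X_pow] at h
  rw [Finset.sum_eq_single (a, b)] at h
  · simpa using h
  · rintro ⟨i, j⟩ - hij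
    split_ifs with hle
    · have : a - i ≠ 0 ∨ b - j ≠ 0 := by
        by_contra hcon
        apply hij
        ext <;> simp <;> omega
      rcases this with h0 | h0 <;> simp [MvPolynomial.smul_eq_C_mul, h0]
    · simp
  · intro hn
    simp [Finsupp.notMem_support_iff.1 hn]

/-- The span of the Hasse derivatives, inside the space of all linear operators on `F[x, y]`. -/
def hasseSpan (F : Type*) [Field F] : Submodule F (Module.End F (Poly₂ F)) :=
  Submodule.span F (Set.range fun p : ℕ × ℕ => hasse F p.1 p.2)

/-- The vector space `𝒟` spanned by the Hasse derivatives. -/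
def DiffSpace (F : Type*) [Field F] : Type _ := hasseSpan F

instance (F : Type*) [Field F] : AddCommGroup (DiffSpace F) :=
  Submodule.addCommGroup (hasseSpan F)

instance (F : Type*) [Field F] : Module F (DiffSpace F) :=
  Submodule.module (hasseSpan F)

/-- The inclusion of `𝒟` in the space of all linear operators on `F[x, y]`. -/
def DiffSpace.toEnd {F : Type*} [Field F] : DiffSpace F →ₗ[F] Module.End F (Poly₂ F) :=
  (hasseSpan F).subtype

/-- The basis `(D_{ij})` of `𝒟`. -/
def hasseBasis (F : Type*) [Field F] : Module.Basis (ℕ × ℕ) F (DiffSpace F) :=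
  Module.Basis.span (linearIndependent_hasse F)

/-- `D_{ij}` as an element of `𝒟`. -/
def D (F : Type*) [Field F] (i j : ℕ) : DiffSpace F := hasseBasis F (i, j)

theorem toEnd_D (F : Type*) [Field F] (i j : ℕ) : (D F i j).toEnd = hasse F i j :=
  congrArg Subtype.val (Module.Basis.span_apply (linearIndependent_hasse F) (i, j))

/-- The antiderivative `A_x` on `𝒟`. -/
def antiX (F : Type*) [Field F] : DiffSpace F →ₗ[F] DiffSpace F :=
  (hasseBasis F).constr F fun p => if 0 < p.1 then D F (p.1 - 1) p.2 else 0

/-- The antiderivative `A_y` on `𝒟`. -/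
def antiY (F : Type*) [Field F] : DiffSpace F →ₗ[F] DiffSpace F :=
  (hasseBasis F).constr F fun p => if 0 < p.2 then D F p.1 (p.2 - 1) else 0

/-- A subspace of `𝒟` is closed if it is finite-dimensional and stable under `A_x`, `A_y`. -/
def IsClosedSubspace {F : Type*} [Field F] (V : Submodule F (DiffSpace F)) : Prop :=
  FiniteDimensional F V ∧ ∀ φ ∈ V, antiX F φ ∈ V ∧ antiY F φ ∈ V

/-- The dual space of the ideal `I` at the point `(x₀, y₀)`. -/
def dualSpace {F : Type*} [Field F] (I : Ideal (Poly₂ F)) (x₀ y₀ : F) :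
    Submodule F (DiffSpace F) where
  carrier := {φ | ∀ p ∈ I,
    MvPolynomial.eval ![x₀, y₀] (φ.toEnd p) = 0}
  add_mem' := by
    intro φ ψ hφ hψ p hp
    simp [hφ p hp, hψ p hp]
  zero_mem' := by
    intro p _
    simp
  smul_mem' := by
    intro t φ hφ p hp
    simp [MvPolynomial.smul_eval, hφ p hp]

/-- `V` is a nontrivial closed subspace of `𝒟` whose Möller indices with respect to `y` are
`α 0, …, α (β - 1)`: here `β = 1 + max {i | D_{i0} ∈ V}`, and for `i < β`, `α i = 1 + max` of the
set of all `j` such that some `D_{ij} + ∑ c_{kℓ} D_{kℓ}`, the sum over finitely many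
`(k, ℓ) ≠ (i, j)` with `ℓ ≤ j`, lies in `V`. (The values `α i` with `i ≥ β` play no role.) -/
structure HasMollerIndices {F : Type*} [Field F] (V : Submodule F (DiffSpace F))
    (β : ℕ) (α : ℕ → ℕ) : Prop where
  closed : IsClosedSubspace V
  nontrivial : V ≠ ⊥
  beta : ∃ b, IsGreatest {i : ℕ | D F i 0 ∈ V} b ∧ β = 1 + b
  alpha : ∀ i < β, ∃ s, IsGreatest
    {j : ℕ | ∃ c : ℕ × ℕ →₀ F, (∀ q ∈ c.support, q ≠ (i, j) ∧ q.2 ≤ j) ∧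
      D F i j + c.sum (fun q t => t • D F q.1 q.2) ∈ V} s ∧ α i = 1 + s

/-- The Möller indices of a subspace are unique. -/
theorem HasMollerIndices.unique {F : Type*} [Field F] {V : Submodule F (DiffSpace F)}
    {β β' : ℕ} {α α' : ℕ → ℕ} (h : HasMollerIndices V β α) (h' : HasMollerIndices V β' α') :
    β = β' ∧ ∀ i < β, α i = α' i := by
  have hβ : β = β' := by
    obtain ⟨b, hb, rfl⟩ := h.beta
    obtain ⟨b', hb', rfl⟩ := h'.beta
    rw [hb.unique hb']
  subst hβ
  refine ⟨rfl, fun i hi => ?_⟩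
  obtain ⟨s, hs, e⟩ := h.alpha i hi
  obtain ⟨s', hs', e'⟩ := h'.alpha i hi
  rw [e, e', hs.unique hs']

/-- The polynomial `(c z + d)^m f((a z + b) / (c z + d), y)`, for `f` of degree at most `m`
in `x`: every monomial `x^i y^j` of `f` becomes `(a z + b)^i (c z + d)^(m - i) y^j`. -/
def mobius {F : Type*} [Field F] (a b c d : F) (m : ℕ) (f : Poly₂ F) : Poly₂ F :=
  ∑ e ∈ f.support, MvPolynomial.C (f.coeff e) *
    (MvPolynomial.C a * MvPolynomial.X 0 + MvPolynomial.C b) ^ e 0 *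
    (MvPolynomial.C c * MvPolynomial.X 0 + MvPolynomial.C d) ^ (m - e 0) *
    MvPolynomial.X 1 ^ e 1

/-- The defining identity of `mobius`, at all points of all field extensions of `F`
(for instance at the generic point). -/
theorem aeval_mobius {F K : Type*} [Field F] [Field K] [Algebra F K] (a b c d : F) (m : ℕ)
    (f : Poly₂ F) (hf : f.degreeOf 0 ≤ m) (z y : K)
    (hz : algebraMap F K c * z + algebraMap F K d ≠ 0) :
    MvPolynomial.aeval ![z, y] (mobius a b c d m f) =
      (algebraMap F K c * z + algebraMap F K d) ^ m *
        MvPolynomial.aeval ![(algebraMap F K a * z + algebraMap F K b) /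
          (algebraMap F K c * z + algebraMap F K d), y] f := by
  rw [MvPolynomial.aeval_def _ f, MvPolynomial.eval₂_eq', mobius, map_sum, Finset.mul_sum]
  refine Finset.sum_congr rfl fun e he => ?_
  have hem : e 0 ≤ m := (MvPolynomial.degreeOf_le_iff.1 hf) e he
  obtain ⟨k, rfl⟩ := Nat.exists_eq_add_of_le hem
  simp only [map_mul, map_pow, map_add, MvPolynomial.aeval_X, MvPolynomial.algHom_C,
    Fin.prod_univ_two, Matrix.cons_val_zero, Matrix.cons_val_one, Nat.add_sub_cancel_left]
  generalize algebraMap F K c * z + algebraMap F K d = w at hz ⊢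
  rw [div_pow, pow_add]
  field_simp

end

end Moller

namespace Moller

noncomputable section

/-! The space `𝒟` acts on `F[Y]⟦Z⟧` by letting `D_{ij}` extract the coefficient of `Z^i Y^j`. The
dual space of an ideal at a point is then the set of functionals killing the Taylor expansions of
its elements. Series in `Z` are needed because `φ(z₀ + Z)` is not a polynomial; since `y` is
untouched, polynomials in `Y` suffice.

Write `φ(z₀ + Z) = x₀ + w(Z)`, where `w` has no constant term and a nonzero linear term. The factor
`cz + d` becomes a unit in the series ring, so the two pairs of generators span the same ideal there
(`span_mobius_map_eq`). A functional killing the Taylor expansions of an ideal kills the whole ideal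
they generate (`pair_eq_zero_of_mem_map`). Hence the transpose `transport w` of the substitution `Z
↦ w` sends the dual space of `⟨f̂, ĝ⟩` into that of `⟨f, g⟩`. The inverse Möbius map gives a map the
other way.

Both transposes preserve the index `j` and are triangular in `i` with nonzero diagonal
(`isTriangular_transport`). Closed subspaces carried into each other by such maps have the same
Möller indices (`HasMollerIndices.congr`). -/

/-! ### Pairing of `𝒟` with power series, and Taylor expansion. -/

open Polynomial in
/-- The coefficient of `Z ^ i * Y ^ j`, on `F[Y]⟦Z⟧`. -/
def bicoeff (F : Type*) [Field F] (i j : ℕ) : PowerSeries F[X] →ₗ[F] F :=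
  (Polynomial.lcoeff F j).comp ((PowerSeries.coeff (R := F[X]) i).restrictScalars F)

theorem bicoeff_apply {F : Type*} [Field F] (i j : ℕ) (h : PowerSeries (Polynomial F)) :
    bicoeff F i j h = (PowerSeries.coeff i h).coeff j := rfl

/-- The action of `𝒟` on `F[Y]⟦Z⟧` in which `D_{ij}` extracts the coefficient of `Z ^ i * Y ^ j`. -/
def pair (F : Type*) [Field F] :
    DiffSpace F →ₗ[F] PowerSeries (Polynomial F) →ₗ[F] F :=
  (hasseBasis F).constr F fun q => bicoeff F q.1 q.2

theorem pair_D {F : Type*} [Field F] (i j : ℕ) (h : PowerSeries (Polynomial F)) :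
    pair F (D F i j) h = (PowerSeries.coeff i h).coeff j := by
  rw [pair, D, Module.Basis.constr_basis, bicoeff_apply]

/-- The substitution of the power series `z` for `x` and of `y₀ + Y` for `y`. -/
def expand {F : Type*} [Field F] (z : PowerSeries F) (y₀ : F) :
    Poly₂ F →ₐ[F] PowerSeries (Polynomial F) :=
  MvPolynomial.aeval ![PowerSeries.map Polynomial.C z,
    PowerSeries.C (Polynomial.X + Polynomial.C y₀)]

/-- The Taylor expansion at `(x₀, y₀)`. -/
abbrev taylor {F : Type*} [Field F] (x₀ y₀ : F) : Poly₂ F →ₐ[F] PowerSeries (Polynomial F) :=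
  expand (PowerSeries.C x₀ + PowerSeries.X) y₀

theorem linearMap_ext_X_pow {F M : Type*} [Field F] [AddCommGroup M] [Module F M]
    {L L' : Poly₂ F →ₗ[F] M}
    (h : ∀ a b : ℕ, L (MvPolynomial.X 0 ^ a * MvPolynomial.X 1 ^ b) =
      L' (MvPolynomial.X 0 ^ a * MvPolynomial.X 1 ^ b)) : L = L' := by
  refine (MvPolynomial.basisMonomials (Fin 2) F).ext fun e => ?_
  have : MvPolynomial.basisMonomials (Fin 2) F e =
      MvPolynomial.X 0 ^ e 0 * MvPolynomial.X 1 ^ e 1 := by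
    simp [MvPolynomial.monomial_eq, Finsupp.prod_fintype]
  rw [this, h]

theorem linearMap_ext_D {F M : Type*} [Field F] [AddCommGroup M] [Module F M]
    {L L' : DiffSpace F →ₗ[F] M} (h : ∀ i j, L (D F i j) = L' (D F i j)) : L = L' :=
  (hasseBasis F).ext fun q => h q.1 q.2

theorem coeff_C_add_X_pow {F : Type*} [Field F] (x₀ : F) (a i : ℕ) :
    PowerSeries.coeff i ((PowerSeries.C x₀ + PowerSeries.X) ^ a) =
      x₀ ^ (a - i) * (a.choose i : F) := by
  have : (PowerSeries.C x₀ + PowerSeries.X) ^ a =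
      (((Polynomial.X + Polynomial.C x₀) ^ a : Polynomial F) : PowerSeries F) := by
    push_cast
    rw [add_comm]
  rw [this, Polynomial.coeff_coe, Polynomial.coeff_X_add_C_pow]

theorem eval_hasse {F : Type*} [Field F] (x₀ y₀ : F) (i j : ℕ) (p : Poly₂ F) :
    MvPolynomial.eval ![x₀, y₀] (hasse F i j p) =
      (PowerSeries.coeff i (taylor x₀ y₀ p)).coeff j := by
  have : (MvPolynomial.aeval (R := F) ![x₀, y₀]).toLinearMap ∘ₗ hasse F i j =
      bicoeff F i j ∘ₗ (taylor x₀ y₀).toLinearMap := by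
    refine linearMap_ext_X_pow fun a b => ?_
    simp only [LinearMap.comp_apply, AlgHom.toLinearMap_apply, bicoeff_apply,
      hasse_X_pow_mul_X_pow, expand, map_mul, map_pow, MvPolynomial.aeval_X,
      Matrix.cons_val_zero, Matrix.cons_val_one]
    rw [← map_pow, ← map_pow, PowerSeries.coeff_mul_C, PowerSeries.coeff_map,
      coeff_C_add_X_pow, Polynomial.coeff_C_mul, Polynomial.coeff_X_add_C_pow]
    split_ifs with h
    · simp
      ring
    · rw [not_and_or, not_le, not_le] at h
      rcases h with h | h <;> simp [Nat.choose_eq_zero_of_lt h]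
  exact (congrArg (fun L : Poly₂ F →ₗ[F] F => L p) this)

theorem eval_toEnd {F : Type*} [Field F] (x₀ y₀ : F) (φ : DiffSpace F) (p : Poly₂ F) :
    MvPolynomial.eval ![x₀, y₀] (φ.toEnd p) = pair F φ (taylor x₀ y₀ p) := by
  have : (MvPolynomial.aeval (R := F) ![x₀, y₀]).toLinearMap ∘ₗ LinearMap.applyₗ p ∘ₗ
      DiffSpace.toEnd = LinearMap.applyₗ (taylor x₀ y₀ p) ∘ₗ pair F := by
    refine linearMap_ext_D fun i j => ?_
    simp only [LinearMap.comp_apply, LinearMap.applyₗ_apply_apply, toEnd_D, pair_D]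
    exact eval_hasse x₀ y₀ i j p
  exact (congrArg (fun L : DiffSpace F →ₗ[F] F => L φ) this)

theorem mem_dualSpace {F : Type*} [Field F] {I : Ideal (Poly₂ F)} {x₀ y₀ : F}
    {φ : DiffSpace F} :
    φ ∈ dualSpace I x₀ y₀ ↔ ∀ p ∈ I, pair F φ (taylor x₀ y₀ p) = 0 := by
  simp only [← eval_toEnd]
  rfl

theorem pair_antiX {F : Type*} [Field F] (φ : DiffSpace F) (h : PowerSeries (Polynomial F)) :
    pair F (antiX F φ) h = pair F φ (PowerSeries.X * h) := by
  have : LinearMap.applyₗ h ∘ₗ pair F ∘ₗ antiX F =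
      LinearMap.applyₗ (PowerSeries.X * h) ∘ₗ pair F := by
    refine linearMap_ext_D fun i j => ?_
    simp only [LinearMap.comp_apply, LinearMap.applyₗ_apply_apply, pair_D]
    rw [antiX, D, Module.Basis.constr_basis]
    cases i with
    | zero => simp
    | succ i => simp [pair_D, PowerSeries.coeff_succ_X_mul]
  exact (congrArg (fun L : DiffSpace F →ₗ[F] F => L φ) this)

theorem pair_antiY {F : Type*} [Field F] (φ : DiffSpace F) (h : PowerSeries (Polynomial F)) :
    pair F (antiY F φ) h = pair F φ (PowerSeries.C Polynomial.X * h) := by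
  have : LinearMap.applyₗ h ∘ₗ pair F ∘ₗ antiY F =
      LinearMap.applyₗ (PowerSeries.C Polynomial.X * h) ∘ₗ pair F := by
    refine linearMap_ext_D fun i j => ?_
    simp only [LinearMap.comp_apply, LinearMap.applyₗ_apply_apply, pair_D]
    rw [antiY, D, Module.Basis.constr_basis]
    cases j with
    | zero => simp
    | succ j => simp [pair_D]
  exact (congrArg (fun L : DiffSpace F →ₗ[F] F => L φ) this)

/-- `A_x` is the transpose of multiplication by `Z`, the Taylor expansion of `x - x₀`, and `I`
absorbs this factor. -/
theorem antiX_mem_dualSpace {F : Type*} [Field F] {I : Ideal (Poly₂ F)} {x₀ y₀ : F}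
    {φ : DiffSpace F} (hφ : φ ∈ dualSpace I x₀ y₀) : antiX F φ ∈ dualSpace I x₀ y₀ := by
  rw [mem_dualSpace] at hφ ⊢
  intro p hp
  have h := hφ _ (I.mul_mem_left (MvPolynomial.X 0 - MvPolynomial.C x₀) hp)
  rw [pair_antiX, ← h]
  simp [expand, PowerSeries.algebraMap_apply, MvPolynomial.algHom_C]

theorem antiY_mem_dualSpace {F : Type*} [Field F] {I : Ideal (Poly₂ F)} {x₀ y₀ : F}
    {φ : DiffSpace F} (hφ : φ ∈ dualSpace I x₀ y₀) : antiY F φ ∈ dualSpace I x₀ y₀ := by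
  rw [mem_dualSpace] at hφ ⊢
  intro p hp
  have h := hφ _ (I.mul_mem_left (MvPolynomial.X 1 - MvPolynomial.C y₀) hp)
  rw [pair_antiY, ← h]
  simp [expand, PowerSeries.algebraMap_apply, MvPolynomial.algHom_C]

/-! ### Coordinates in `𝒟`, and finite-dimensionality of dual spaces. -/

/-- The coefficient of `D_{ij}`. -/
def coord {F : Type*} [Field F] (φ : DiffSpace F) (i j : ℕ) : F := (hasseBasis F).repr φ (i, j)

theorem coord_D {F : Type*} [Field F] (i j k l : ℕ) :
    coord (D F i j) k l = if i = k ∧ j = l then 1 else 0 := by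
  simp [coord, D, Finsupp.single_apply]

theorem pair_X_pow {F : Type*} [Field F] (φ : DiffSpace F) (i j : ℕ) :
    pair F φ (PowerSeries.X ^ i * PowerSeries.C (Polynomial.X ^ j)) = coord φ i j := by
  have : LinearMap.applyₗ (PowerSeries.X ^ i * PowerSeries.C (Polynomial.X ^ j)) ∘ₗ pair F =
      (hasseBasis F).coord (i, j) := by
    refine linearMap_ext_D fun k l => ?_
    have h : (hasseBasis F).coord (i, j) (D F k l) = coord (D F k l) i j := rfl
    rw [h, coord_D]
    simp only [LinearMap.comp_apply, LinearMap.applyₗ_apply_apply, pair_D,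
      PowerSeries.coeff_mul_C, PowerSeries.coeff_X_pow]
    split_ifs <;> simp_all [Polynomial.coeff_X_pow, eq_comm]
  exact (congrArg (fun L : DiffSpace F →ₗ[F] F => L φ) this)

theorem coord_antiX {F : Type*} [Field F] (φ : DiffSpace F) (i j : ℕ) :
    coord (antiX F φ) i j = coord φ (i + 1) j := by
  rw [← pair_X_pow, pair_antiX, ← mul_assoc, ← pow_succ', pair_X_pow]

theorem coord_ext {F : Type*} [Field F] {φ ψ : DiffSpace F}
    (h : ∀ i j, coord φ i j = coord ψ i j) : φ = ψ :=
  (hasseBasis F).repr.injective (Finsupp.ext fun q => h q.1 q.2)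

theorem coord_add {F : Type*} [Field F] (φ ψ : DiffSpace F) (i j : ℕ) :
    coord (φ + ψ) i j = coord φ i j + coord ψ i j := by simp [coord]

theorem coord_smul {F : Type*} [Field F] (t : F) (φ : DiffSpace F) (i j : ℕ) :
    coord (t • φ) i j = t * coord φ i j := by simp [coord]

theorem coord_antiX_pow {F : Type*} [Field F] (n : ℕ) (φ : DiffSpace F) (i j : ℕ) :
    coord ((antiX F ^ n) φ) i j = coord φ (i + n) j := by
  induction n generalizing i with
  | zero => simp
  | succ n ih => rw [pow_succ', Module.End.mul_apply, coord_antiX, ih]; congr 1; ring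

/-- The polynomials `(x - x₀)^i (y - y₀)^j` expand to `Z^i Y^j` and so read off all coordinates.
Hence `𝒟` embeds in the dual of `F[x, y]`, and the dual space lands in the annihilator of `I`, which
is the dual of the finite-dimensional quotient. -/
theorem finite_dualSpace {F : Type*} [Field F] {I : Ideal (Poly₂ F)}
    (hI : IsZeroDimensional I) (x₀ y₀ : F) : FiniteDimensional F (dualSpace I x₀ y₀) := by
  let L : DiffSpace F →ₗ[F] Module.Dual F (Poly₂ F) :=
    LinearMap.lcomp F F (taylor x₀ y₀).toLinearMap ∘ₗ pair F
  have hL : ∀ φ p, L φ p = pair F φ (taylor x₀ y₀ p) := fun _ _ => rfl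
  have hinj : Function.Injective L := by
    intro φ ψ h
    refine coord_ext fun i j => ?_
    have h := LinearMap.congr_fun h ((MvPolynomial.X 0 - MvPolynomial.C x₀) ^ i *
      (MvPolynomial.X 1 - MvPolynomial.C y₀) ^ j)
    simp only [hL] at h
    have e : taylor x₀ y₀ ((MvPolynomial.X 0 - MvPolynomial.C x₀) ^ i *
      (MvPolynomial.X 1 - MvPolynomial.C y₀) ^ j) =
        PowerSeries.X ^ i * PowerSeries.C (Polynomial.X ^ j) := by
      simp [expand, PowerSeries.algebraMap_apply, MvPolynomial.algHom_C]
    rwa [e, pair_X_pow, pair_X_pow] at h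
  let J : Submodule F (Poly₂ F) := I.restrictScalars F
  have : Module.Finite F (Poly₂ F ⧸ J) := hI
  let R : dualSpace I x₀ y₀ →ₗ[F] J.dualAnnihilator :=
    (L.domRestrict (dualSpace I x₀ y₀)).codRestrict J.dualAnnihilator fun φ =>
      (Submodule.mem_dualAnnihilator _).2 (mem_dualSpace.1 φ.2)
  have hR : Function.Injective R := fun φ ψ h => Subtype.ext (hinj (congrArg Subtype.val h))
  exact Module.Finite.of_injective (J.dualQuotEquivDualAnnihilator.symm.toLinearMap ∘ₗ R)
    (J.dualQuotEquivDualAnnihilator.symm.injective.comp hR)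

/-! ### The transpose of a substitution. -/

/-- The transpose of the substitution of `w` for `Z`. -/
def transport {F : Type*} [Field F] (w : PowerSeries F) : DiffSpace F →ₗ[F] DiffSpace F :=
  (hasseBasis F).constr F fun q =>
    ∑ k ∈ Finset.range (q.1 + 1), PowerSeries.coeff q.1 (w ^ k) • D F k q.2

theorem transport_D {F : Type*} [Field F] (w : PowerSeries F) (i j : ℕ) :
    transport w (D F i j) =
      ∑ k ∈ Finset.range (i + 1), PowerSeries.coeff i (w ^ k) • D F k j := by
  rw [transport, D, Module.Basis.constr_basis]

theorem coeff_pow_eq_zero {F : Type*} [Field F] {w : PowerSeries F}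
    (hw : PowerSeries.constantCoeff w = 0) {i k : ℕ} (h : i < k) :
    PowerSeries.coeff i (w ^ k) = 0 := by
  obtain ⟨v, rfl⟩ := PowerSeries.X_dvd_iff.2 hw
  rw [mul_pow, PowerSeries.coeff_X_pow_mul', if_neg (by omega)]

theorem coeff_pow_self {F : Type*} [Field F] {w : PowerSeries F}
    (hw : PowerSeries.constantCoeff w = 0) (i : ℕ) :
    PowerSeries.coeff i (w ^ i) = PowerSeries.coeff 1 w ^ i := by
  obtain ⟨v, rfl⟩ := PowerSeries.X_dvd_iff.2 hw
  rw [mul_pow, PowerSeries.coeff_X_pow_mul', if_pos le_rfl]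
  have : PowerSeries.coeff 1 (PowerSeries.X * v) = PowerSeries.constantCoeff v := by
    simp
  simp [this]

/-- By linearity it is enough to treat `(x - x₀)^a (y - y₀)^b`, whose two expansions are `Z^a Y^b`
and `w^a Y^b`. As `w` has no constant term, `w^a` has no `Z^i` term for `a > i`, so cutting the sum
in `transport` at `k = i` loses nothing. -/
theorem pair_transport {F : Type*} [Field F] {w : PowerSeries F}
    (hw : PowerSeries.constantCoeff w = 0) (φ : DiffSpace F) (x₀ y₀ : F) (p : Poly₂ F) :
    pair F (transport w φ) (taylor x₀ y₀ p) =
      pair F φ (expand (PowerSeries.C x₀ + w) y₀ p) := by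
  let S : Poly₂ F →ₐ[F] Poly₂ F := MvPolynomial.aeval
    ![MvPolynomial.X 0 - MvPolynomial.C x₀, MvPolynomial.X 1 - MvPolynomial.C y₀]
  let S' : Poly₂ F →ₐ[F] Poly₂ F := MvPolynomial.aeval
    ![MvPolynomial.X 0 + MvPolynomial.C x₀, MvPolynomial.X 1 + MvPolynomial.C y₀]
  have hS : S.comp S' = AlgHom.id F _ := by
    ext i : 1
    fin_cases i <;> simp [S, S', MvPolynomial.algHom_C]
  have hp : S (S' p) = p := DFunLike.congr_fun hS p
  rw [← hp]
  generalize S' p = q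
  have key : ((pair F).compl₁₂ (transport w) ((taylor x₀ y₀).comp S).toLinearMap) =
      (pair F).compl₁₂ LinearMap.id ((expand (PowerSeries.C x₀ + w) y₀).comp S).toLinearMap := by
    refine linearMap_ext_D fun i j => linearMap_ext_X_pow fun a b => ?_
    simp only [LinearMap.compl₁₂_apply, AlgHom.toLinearMap_apply, AlgHom.comp_apply,
      LinearMap.id_apply, transport_D]
    have h (v : PowerSeries F) : expand (PowerSeries.C x₀ + v) y₀
        (S (MvPolynomial.X 0 ^ a * MvPolynomial.X 1 ^ b)) =
        PowerSeries.map Polynomial.C (v ^ a) * PowerSeries.C (Polynomial.X ^ b) := by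
      simp [S, expand, PowerSeries.algebraMap_apply, MvPolynomial.algHom_C]
    rw [taylor, h, h]
    simp only [map_sum, LinearMap.sum_apply, map_smul, LinearMap.smul_apply, pair_D,
      PowerSeries.coeff_mul_C, PowerSeries.coeff_map, Polynomial.coeff_C_mul,
      PowerSeries.coeff_X_pow]
    by_cases hai : a ≤ i
    · rw [Finset.sum_eq_single_of_mem a (Finset.mem_range.2 (by omega))]
      · simp
      · intro k _ hk
        simp [hk]
    · rw [coeff_pow_eq_zero hw (not_le.1 hai), zero_mul]
      refine Finset.sum_eq_zero fun k hk => ?_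
      rw [Finset.mem_range] at hk
      simp [show k ≠ a by omega]
  exact LinearMap.congr_fun (LinearMap.congr_fun key φ) q

/-! ### Triangular maps and closed subspaces. -/

/-- `T` is triangular with respect to the `x`-degree, for each `y`-degree separately, with
nonzero diagonal. -/
def IsTriangular {F : Type*} [Field F] (T : DiffSpace F →ₗ[F] DiffSpace F) : Prop :=
  ∃ u : ℕ → F, (∀ i, u i ≠ 0) ∧ ∀ φ i j, (∀ k, i < k → coord φ k j = 0) →
    coord (T φ) i j = u i * coord φ i j

/-- The coordinate of the image at `(i, j)` is the sum over `k` of `coord φ k j` times the `Z^k`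
coefficient of `w^i`. Terms with `k < i` vanish because `Z^i` divides `w^i`, those with `k > i` by
hypothesis on `φ`, and the diagonal entry is the `i`-th power of the linear coefficient of `w`. -/
theorem isTriangular_transport {F : Type*} [Field F] {w : PowerSeries F}
    (hw : PowerSeries.constantCoeff w = 0) (hw' : PowerSeries.coeff 1 w ≠ 0) :
    IsTriangular (transport w) := by
  refine ⟨fun i => PowerSeries.coeff 1 w ^ i, fun i => pow_ne_zero _ hw', fun φ i j h => ?_⟩
  have e : coord (transport w φ) i j =
      pair F φ (PowerSeries.map Polynomial.C (w ^ i) * PowerSeries.C (Polynomial.X ^ j)) := by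
    have := pair_transport hw φ 0 0 (MvPolynomial.X 0 ^ i * MvPolynomial.X 1 ^ j)
    simpa [expand, ← pair_X_pow] using this
  change _ = PowerSeries.coeff 1 w ^ i * _
  rw [e, ← coeff_pow_self hw]
  conv_lhs => rw [← (hasseBasis F).linearCombination_repr φ]
  rw [Finsupp.linearCombination_apply, Finsupp.sum, map_sum, LinearMap.sum_apply,
    Finset.sum_eq_single (i, j)]
  · change pair F (coord φ i j • D F i j) _ = _
    rw [map_smul, LinearMap.smul_apply, pair_D, PowerSeries.coeff_mul_C, PowerSeries.coeff_map,
      Polynomial.coeff_C_mul, Polynomial.coeff_X_pow_self, mul_one, smul_eq_mul, mul_comm]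
  · rintro ⟨k, l⟩ - hkl
    change pair F (coord φ k l • D F k l) _ = _
    rw [map_smul, LinearMap.smul_apply, pair_D, PowerSeries.coeff_mul_C, PowerSeries.coeff_map,
      Polynomial.coeff_C_mul, Polynomial.coeff_X_pow]
    by_cases hl : l = j
    · subst hl
      rcases lt_trichotomy k i with hk | rfl | hk
      · simp [coeff_pow_eq_zero hw hk]
      · exact absurd rfl hkl
      · simp [h k hk]
    · simp [hl]
  · intro h
    rw [Finsupp.notMem_support_iff.1 h]
    simp

theorem exists_coord_eq_zero {F : Type*} [Field F] (φ : DiffSpace F) :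
    ∃ N, ∀ i j, N ≤ i ∨ N ≤ j → coord φ i j = 0 := by
  let s := ((hasseBasis F).repr φ).support
  refine ⟨s.sup (fun q => q.1 + q.2 + 1), fun i j hij => ?_⟩
  by_contra h
  have : (i, j) ∈ s := Finsupp.mem_support_iff.2 h
  have := Finset.le_sup (f := fun q : ℕ × ℕ => q.1 + q.2 + 1) this
  simp only at this
  omega

/-- If some `D_{i'j}` with `i' ≥ i` occurs in `φ`, there is a last one. -/
theorem exists_last_coord {F : Type*} [Field F] {φ : DiffSpace F} {i j : ℕ}
    (h : coord φ i j ≠ 0) :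
    ∃ k, i ≤ k ∧ coord φ k j ≠ 0 ∧ ∀ l, k < l → coord φ l j = 0 := by
  classical
  obtain ⟨N, hN⟩ := exists_coord_eq_zero φ
  have hi : i ≤ N := by
    by_contra hc
    exact h (hN i j (Or.inl (by omega)))
  refine ⟨Nat.findGreatest (fun k => coord φ k j ≠ 0) N, Nat.le_findGreatest hi h,
    Nat.findGreatest_spec (P := fun k => coord φ k j ≠ 0) hi h, fun l hl => ?_⟩
  by_cases hlN : l ≤ N
  · exact not_not.1 (Nat.findGreatest_is_greatest hl hlN)
  · exact hN l j (Or.inl (by omega))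

/-- For fixed `j`, the last nonzero coordinate of `φ` is only rescaled by `T`. -/
theorem IsTriangular.injective {F : Type*} [Field F] {T : DiffSpace F →ₗ[F] DiffSpace F}
    (hT : IsTriangular T) : Function.Injective T := by
  obtain ⟨u, hu, hT⟩ := hT
  rw [injective_iff_map_eq_zero]
  intro φ hφ
  refine coord_ext fun i j => ?_
  by_contra h
  obtain ⟨k, -, hk, hlast⟩ := exists_last_coord (φ := φ) (i := i) (j := j) (by simpa [coord] using h)
  have := hT φ k j hlast
  rw [hφ] at this
  exact mul_ne_zero (hu k) hk (by simpa [coord] using this.symm)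

theorem IsTriangular.coord_eq_zero {F : Type*} [Field F] {T : DiffSpace F →ₗ[F] DiffSpace F}
    (hT : IsTriangular T) {φ : DiffSpace F} {i j : ℕ} (h : ∀ k, i ≤ k → coord φ k j = 0) :
    coord (T φ) i j = 0 := by
  obtain ⟨u, hu, hT⟩ := hT
  rw [hT φ i j fun k hk => h k hk.le, h i le_rfl, mul_zero]

theorem antiX_pow_mem {F : Type*} [Field F] {V : Submodule F (DiffSpace F)}
    (hV : IsClosedSubspace V) {φ : DiffSpace F} (hφ : φ ∈ V) (n : ℕ) :
    (antiX F ^ n) φ ∈ V := by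
  induction n with
  | zero => exact hφ
  | succ n ih => rw [pow_succ', Module.End.mul_apply]; exact (hV.2 _ ih).1

theorem antiX_pow_D {F : Type*} [Field F] (n i j : ℕ) :
    (antiX F ^ n) (D F (i + n) j) = D F i j := by
  refine coord_ext fun k l => ?_
  rw [coord_antiX_pow, coord_D, coord_D]
  simp

theorem D_zero_mem_of_le {F : Type*} [Field F] {V : Submodule F (DiffSpace F)}
    (hV : IsClosedSubspace V) {i k : ℕ} (h : D F i 0 ∈ V) (hk : k ≤ i) : D F k 0 ∈ V := by
  obtain ⟨n, rfl⟩ := Nat.exists_eq_add_of_le hk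
  rw [← antiX_pow_D n]
  exact antiX_pow_mem hV h n

/-! ### Möller indices and their invariance. -/

/-- The set whose maximum is `α(i) - 1`. -/
def indexSet {F : Type*} [Field F] (V : Submodule F (DiffSpace F)) (i : ℕ) : Set ℕ :=
  {j : ℕ | ∃ c : ℕ × ℕ →₀ F, (∀ q ∈ c.support, q ≠ (i, j) ∧ q.2 ≤ j) ∧
      D F i j + c.sum (fun q t => t • D F q.1 q.2) ∈ V}

theorem mem_indexSet {F : Type*} [Field F] {V : Submodule F (DiffSpace F)} {i j : ℕ} :
    j ∈ indexSet V i ↔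
      ∃ φ ∈ V, coord φ i j = 1 ∧ ∀ k l, j < l → coord φ k l = 0 := by
  have hc (c : ℕ × ℕ →₀ F) : (hasseBasis F).repr (c.sum fun q t => t • D F q.1 q.2) = c :=
    (hasseBasis F).repr_linearCombination c
  constructor
  · rintro ⟨c, hcs, hV⟩
    refine ⟨_, hV, ?_, fun k l hl => ?_⟩
    · have : c (i, j) = 0 := by
        by_contra h
        exact (hcs _ (Finsupp.mem_support_iff.2 h)).1 rfl
      rw [coord_add, coord_D, coord, hc, this]
      simp
    · have : c (k, l) = 0 := by
        by_contra h
        exact absurd (hcs _ (Finsupp.mem_support_iff.2 h)).2 (not_le.2 hl)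
      rw [coord_add, coord_D, coord, hc, this, if_neg (by omega), add_zero]
  · rintro ⟨φ, hφ, h1, h0⟩
    refine ⟨((hasseBasis F).repr φ).erase (i, j), fun q hq => ?_, ?_⟩
    · rw [Finsupp.support_erase, Finset.mem_erase] at hq
      refine ⟨hq.1, ?_⟩
      by_contra h
      exact Finsupp.mem_support_iff.1 hq.2 (h0 q.1 q.2 (not_le.1 h))
    · convert hφ
      refine coord_ext fun k l => ?_
      rw [coord_add, coord_D, coord, hc]
      by_cases h : i = k ∧ j = l
      · obtain ⟨rfl, rfl⟩ := h
        simp [h1]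
      · rw [if_neg h, zero_add, Finsupp.erase_ne (by simp; tauto)]
        rfl

theorem mem_indexSet_of_ne_zero {F : Type*} [Field F] {V : Submodule F (DiffSpace F)} {i j : ℕ}
    {φ : DiffSpace F} (hφ : φ ∈ V) (h : coord φ i j ≠ 0) (h0 : ∀ k l, j < l → coord φ k l = 0) :
    j ∈ indexSet V i := by
  refine mem_indexSet.2 ⟨(coord φ i j)⁻¹ • φ, V.smul_mem _ hφ, ?_, fun k l hl => ?_⟩
  · rw [coord_smul, inv_mul_cancel₀ h]
  · rw [coord_smul, h0 k l hl, mul_zero]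

/-- Terms `D_{kj}` of `φ` with `k > i` could cancel the coordinate at `(i, j)` under `T`. Closedness
removes them: a power of `A_x` shifts the last term with second index `j` to `D_{ij}`, and no term
with larger second index appears. The resulting coefficient is nonzero, and rescaling makes it `1`.
-/
theorem IsTriangular.indexSet_subset {F : Type*} [Field F] {T : DiffSpace F →ₗ[F] DiffSpace F}
    (hT : IsTriangular T) {V W : Submodule F (DiffSpace F)} (hV : IsClosedSubspace V)
    (hVW : ∀ φ ∈ V, T φ ∈ W) (i : ℕ) : indexSet V i ⊆ indexSet W i := by
  intro j hj
  obtain ⟨φ, hφ, h1, h0⟩ := mem_indexSet.1 hj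
  obtain ⟨k, hik, hk, hlast⟩ := exists_last_coord (φ := φ) (i := i) (j := j) (by simp [h1])
  obtain ⟨n, rfl⟩ := Nat.exists_eq_add_of_le hik
  have hz : ∀ l, i < l → coord ((antiX F ^ n) φ) l j = 0 := fun l hl => by
    rw [coord_antiX_pow, hlast _ (by omega)]
  refine mem_indexSet_of_ne_zero (hVW _ (antiX_pow_mem hV hφ n)) ?_ fun k l hl => ?_
  · obtain ⟨u, hu, hT⟩ := hT
    rw [hT _ _ _ hz, coord_antiX_pow]
    exact mul_ne_zero (hu i) hk
  · refine hT.coord_eq_zero fun k' _ => ?_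
    rw [coord_antiX_pow, h0 _ _ hl]

/-- The image of `D_{i0}` is a combination of the `D_{k0}` with `k ≤ i`, with nonzero coefficient at
`k = i`. The lower ones lie in `V` by closedness, hence in `W` by induction, and can be subtracted.
-/
theorem IsTriangular.D_zero_mem {F : Type*} [Field F] {T : DiffSpace F →ₗ[F] DiffSpace F}
    (hT : IsTriangular T) {V W : Submodule F (DiffSpace F)} (hV : IsClosedSubspace V)
    (hVW : ∀ φ ∈ V, T φ ∈ W) {i : ℕ} (hi : D F i 0 ∈ V) : D F i 0 ∈ W := by
  induction i using Nat.strong_induction_on with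
  | _ i ih =>
    have hlow : ∀ k, k < i → D F k 0 ∈ W := fun k hk => ih k hk (D_zero_mem_of_le hV hi hk.le)
    have key : T (D F i 0) = ∑ k ∈ Finset.range (i + 1), coord (T (D F i 0)) k 0 • D F k 0 := by
      refine coord_ext fun k l => ?_
      have hs : coord (∑ k ∈ Finset.range (i + 1), coord (T (D F i 0)) k 0 • D F k 0) k l =
          ∑ k' ∈ Finset.range (i + 1), coord (T (D F i 0)) k' 0 * coord (D F k' 0) k l := by
        simp [coord]
      rw [hs]
      by_cases hl : l = 0
      · subst hl
        by_cases hk : k ≤ i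
        · rw [Finset.sum_eq_single_of_mem k (Finset.mem_range.2 (by omega))]
          · simp [coord_D]
          · intro k' _ hk'
            simp [coord_D, hk']
        · rw [Finset.sum_eq_zero]
          · refine hT.coord_eq_zero fun k' hk' => ?_
            rw [coord_D, if_neg (by omega)]
          · intro k' hk'
            rw [Finset.mem_range] at hk'
            rw [coord_D, if_neg (by omega), mul_zero]
      · rw [Finset.sum_eq_zero]
        · refine hT.coord_eq_zero fun k' hk' => ?_
          rw [coord_D, if_neg (by omega)]
        · intro k' hk'
          rw [coord_D, if_neg (by omega), mul_zero]
    have hTW := hVW _ hi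
    rw [key, Finset.sum_range_succ] at hTW
    have hsum : ∑ k ∈ Finset.range i, coord (T (D F i 0)) k 0 • D F k 0 ∈ W :=
      W.sum_mem fun k hk => W.smul_mem _ (hlow k (Finset.mem_range.1 hk))
    have h := (W.add_mem_iff_right hsum).1 hTW
    obtain ⟨u, hu, hT⟩ := hT
    refine (W.smul_mem_iff ?_).1 h
    rw [hT _ _ _ fun k hk => by rw [coord_D, if_neg (by omega)], coord_D]
    simpa using hu i

theorem exists_bound {F : Type*} [Field F] {V : Submodule F (DiffSpace F)}
    (hV : FiniteDimensional F V) :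
    ∃ N, ∀ φ ∈ V, ∀ i j, N ≤ i ∨ N ≤ j → coord φ i j = 0 := by
  obtain ⟨s, hs⟩ := Module.Finite.iff_fg.1 hV
  choose N hN using exists_coord_eq_zero (F := F)
  refine ⟨s.sup N, fun φ hφ i j hij => ?_⟩
  rw [← hs] at hφ
  induction hφ using Submodule.span_induction with
  | mem φ h =>
    have := Finset.le_sup (f := N) h
    exact hN φ i j (by omega)
  | zero => simp [coord]
  | add φ ψ _ _ h h' => rw [coord_add, h, h', add_zero]
  | smul t φ _ h => rw [coord_smul, h, mul_zero]

theorem exists_isGreatest {s : Set ℕ} (hs : s.Nonempty) {N : ℕ} (hN : ∀ i ∈ s, i < N) :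
    ∃ b, IsGreatest s b :=
  ⟨sSup s, Nat.sSup_mem hs ⟨N, fun i hi => (hN i hi).le⟩,
    fun _ hi => le_csSup ⟨N, fun i hi => (hN i hi).le⟩ hi⟩

theorem exists_hasMollerIndices {F : Type*} [Field F] {V : Submodule F (DiffSpace F)}
    (hV : IsClosedSubspace V) (h0 : D F 0 0 ∈ V) : ∃ β α, HasMollerIndices V β α := by
  obtain ⟨N, hN⟩ := exists_bound hV.1
  obtain ⟨b, hb⟩ : ∃ b, IsGreatest {i : ℕ | D F i 0 ∈ V} b := by
    refine exists_isGreatest ⟨0, h0⟩ (N := N) fun i hi => ?_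
    by_contra h
    simpa [coord_D] using hN _ hi i 0 (by omega)
  -- The bound on `i` sits under the existential so that `choose` yields a total function; its
  -- values beyond `b` are arbitrary.
  have hα : ∀ i, ∃ s, i < 1 + b → IsGreatest (indexSet V i) s := fun i => by
    by_cases hi : i < 1 + b
    · obtain ⟨s, hs⟩ : ∃ s, IsGreatest (indexSet V i) s := by
        -- `D_{i0}` itself lies in `V` because `i ≤ b`, so `0` belongs to the index set.
        refine exists_isGreatest ⟨0, ?_⟩ (N := N) fun j hj => ?_
        · refine mem_indexSet_of_ne_zero (D_zero_mem_of_le hV hb.1 (k := i) (by omega)) ?_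
            fun k l hl => ?_
          · simp [coord_D]
          · rw [coord_D, if_neg (by omega)]
        · obtain ⟨φ, hφ, h1, -⟩ := mem_indexSet.1 hj
          by_contra h
          rw [hN φ hφ i j (by omega)] at h1
          exact zero_ne_one h1
      exact ⟨s, fun _ => hs⟩
    · exact ⟨0, fun h => absurd h hi⟩
  choose s hs using hα
  refine ⟨1 + b, fun i => 1 + s i, hV, ?_, ⟨b, hb, rfl⟩, fun i hi => ⟨s i, hs i hi, rfl⟩⟩
  rintro rfl
  have : coord (D F 0 0) 0 0 = 0 := by rw [(Submodule.mem_bot F).1 h0]; simp [coord]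
  simp [coord_D] at this

/-- Möller indices are preserved under triangular maps in both directions. -/
theorem HasMollerIndices.congr {F : Type*} [Field F] {V W : Submodule F (DiffSpace F)}
    {T T' : DiffSpace F →ₗ[F] DiffSpace F} (hT : IsTriangular T) (hT' : IsTriangular T')
    (hW : IsClosedSubspace W) (hVW : ∀ φ ∈ V, T φ ∈ W) (hWV : ∀ φ ∈ W, T' φ ∈ V)
    {β : ℕ} {α : ℕ → ℕ} (h : HasMollerIndices V β α) : HasMollerIndices W β α := by
  have hV := h.closed
  have hβ : {i : ℕ | D F i 0 ∈ V} = {i : ℕ | D F i 0 ∈ W} :=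
    Set.ext fun i => ⟨hT.D_zero_mem hV hVW, hT'.D_zero_mem hW hWV⟩
  have hα (i : ℕ) : indexSet V i = indexSet W i :=
    (hT.indexSet_subset hV hVW i).antisymm (hT'.indexSet_subset hW hWV i)
  refine ⟨hW, ?_, hβ ▸ h.beta, fun i hi => ?_⟩
  · rintro rfl
    refine h.nontrivial ((Submodule.eq_bot_iff V).2 fun φ hφ => hT.injective ?_)
    rw [(Submodule.mem_bot F).1 (hVW φ hφ), map_zero]
  · have := h.alpha i hi
    change ∃ s, IsGreatest (indexSet V i) s ∧ _ at this
    rw [hα] at this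
    exact this

/-! ### From a polynomial ideal to the ideal it generates in `F[Y]⟦Z⟧`. -/

theorem coe_mem_range_taylor {F : Type*} [Field F] (x₀ y₀ : F)
    (P : Polynomial (Polynomial F)) :
    (P : PowerSeries (Polynomial F)) ∈ (taylor x₀ y₀).range := by
  have hC (t : F) : PowerSeries.C (Polynomial.C t) ∈ (taylor x₀ y₀).range :=
    ⟨MvPolynomial.C t, by simp [PowerSeries.algebraMap_apply, MvPolynomial.algHom_C]⟩
  have hX : PowerSeries.X ∈ (taylor x₀ y₀).range :=
    ⟨MvPolynomial.X 0 - MvPolynomial.C x₀, by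
      simp [expand, PowerSeries.algebraMap_apply, MvPolynomial.algHom_C]⟩
  have hY : PowerSeries.C Polynomial.X ∈ (taylor x₀ y₀).range :=
    ⟨MvPolynomial.X 1 - MvPolynomial.C y₀, by
      simp [expand, PowerSeries.algebraMap_apply, MvPolynomial.algHom_C]⟩
  have hpoly (t : Polynomial F) : PowerSeries.C t ∈ (taylor x₀ y₀).range := by
    induction t using Polynomial.induction_on' with
    | add p q hp hq => rw [map_add]; exact add_mem hp hq
    | monomial n t =>
      rw [← Polynomial.C_mul_X_pow_eq_monomial, map_mul, map_pow]
      exact mul_mem (hC t) (pow_mem hY n)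
  induction P using Polynomial.induction_on' with
  | add p q hp hq => rw [Polynomial.coe_add]; exact add_mem hp hq
  | monomial n t =>
    rw [← Polynomial.C_mul_X_pow_eq_monomial, Polynomial.coe_mul, Polynomial.coe_pow,
      Polynomial.coe_X, Polynomial.coe_C]
    exact mul_mem (hpoly t) (pow_mem hX n)

theorem pair_X_pow_mul {F : Type*} [Field F] (n : ℕ) (φ : DiffSpace F)
    (h : PowerSeries (Polynomial F)) :
    pair F φ (PowerSeries.X ^ n * h) = pair F ((antiX F ^ n) φ) h := by
  induction n generalizing h with
  | zero => simp
  | succ n ih => rw [pow_succ' (antiX F), Module.End.mul_apply, pair_antiX, ← ih, pow_succ, mul_assoc]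

/-- Since `φ` has finitely many terms, some power `A_x^N` kills it, so only `h` modulo `Z^N`
matters. The truncation is a polynomial, hence the Taylor expansion of some `r`, and `r * q` lies in
`J`. -/
theorem pair_mul_taylor_eq_zero {F : Type*} [Field F] {J : Ideal (Poly₂ F)} {x₀ y₀ : F}
    {φ : DiffSpace F} (hφ : φ ∈ dualSpace J x₀ y₀) {q : Poly₂ F} (hq : q ∈ J)
    (h : PowerSeries (Polynomial F)) : pair F φ (h * taylor x₀ y₀ q) = 0 := by
  obtain ⟨N, hN⟩ := exists_coord_eq_zero φ
  have hA : (antiX F ^ N) φ = 0 := coord_ext fun i j => by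
    rw [coord_antiX_pow, hN _ _ (Or.inl (by omega))]
    simp [coord]
  obtain ⟨r, hr⟩ := coe_mem_range_taylor x₀ y₀ (PowerSeries.trunc N h)
  rw [h.eq_X_pow_mul_shift_add_trunc N, add_mul, map_add, mul_assoc, pair_X_pow_mul, hA, ← hr]
  have h1 := mem_dualSpace.1 hφ _ (J.mul_mem_left r hq)
  rw [map_mul] at h1
  simpa using h1

theorem pair_eq_zero_of_mem_map {F : Type*} [Field F] {J : Ideal (Poly₂ F)} {x₀ y₀ : F}
    {φ : DiffSpace F} (hφ : φ ∈ dualSpace J x₀ y₀) {h : PowerSeries (Polynomial F)}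
    (hh : h ∈ J.map (taylor x₀ y₀)) : pair F φ h = 0 := by
  -- The arbitrary factor `g` makes the statement stable under scalar multiplication in the
  -- induction on the span.
  suffices H : ∀ g, pair F φ (g * h) = 0 by simpa using H 1
  induction hh using Submodule.span_induction with
  | mem h hh =>
    obtain ⟨q, hq, rfl⟩ := hh
    exact pair_mul_taylor_eq_zero hφ hq
  | zero => simp
  | add h h' _ _ ih ih' => intro g; rw [mul_add, map_add, ih, ih', add_zero]
  | smul r h _ ih => intro g; rw [smul_eq_mul, ← mul_assoc, ih]

theorem transport_mem_dualSpace {F : Type*} [Field F] {I J : Ideal (Poly₂ F)} {x₀ z₀ y₀ : F}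
    {w : PowerSeries F} (hw : PowerSeries.constantCoeff w = 0)
    (hIJ : I ≤ (J.map (taylor z₀ y₀)).comap (expand (PowerSeries.C x₀ + w) y₀))
    {φ : DiffSpace F} (hφ : φ ∈ dualSpace J z₀ y₀) : transport w φ ∈ dualSpace I x₀ y₀ :=
  mem_dualSpace.2 fun p hp => by
    rw [pair_transport hw]
    exact pair_eq_zero_of_mem_map hφ (hIJ hp)

/-! ### The Möbius substitution in power series. -/

/-- The defining identity of `mobius`, without divisions. -/
theorem aeval_mobius_of_mul_eq {F R : Type*} [Field F] [CommRing R] [Algebra F R] {a b c d : F}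
    {m : ℕ} {f : Poly₂ F} (hf : f.degreeOf 0 ≤ m) {z x : R} (y : R)
    (h : (algebraMap F R c * z + algebraMap F R d) * x =
      algebraMap F R a * z + algebraMap F R b) :
    MvPolynomial.aeval ![z, y] (mobius a b c d m f) =
      (algebraMap F R c * z + algebraMap F R d) ^ m * MvPolynomial.aeval ![x, y] f := by
  rw [MvPolynomial.aeval_def _ f, MvPolynomial.eval₂_eq', mobius, map_sum, Finset.mul_sum]
  refine Finset.sum_congr rfl fun e he => ?_
  have hem : e 0 ≤ m := (MvPolynomial.degreeOf_le_iff.1 hf) e he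
  obtain ⟨k, rfl⟩ := Nat.exists_eq_add_of_le hem
  simp only [map_mul, map_pow, map_add, MvPolynomial.aeval_X, MvPolynomial.algHom_C,
    Fin.prod_univ_two, Matrix.cons_val_zero, Matrix.cons_val_one, Nat.add_sub_cancel_left,
    ← h, mul_pow]
  ring

/-- The expansion of `(a z + b) / (c z + d)` in `z - z₀`. -/
theorem exists_mobius_series {F : Type*} [Field F] {a b c d x₀ z₀ : F} (hz₀ : c * z₀ + d ≠ 0)
    (hx₀ : (c * z₀ + d) * x₀ = a * z₀ + b) (hac : a - c * x₀ ≠ 0) :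
    ∃ w : PowerSeries F, PowerSeries.constantCoeff w = 0 ∧ PowerSeries.coeff 1 w ≠ 0 ∧
      (PowerSeries.C c * (PowerSeries.C z₀ + PowerSeries.X) + PowerSeries.C d) *
          (PowerSeries.C x₀ + w) =
        PowerSeries.C a * (PowerSeries.C z₀ + PowerSeries.X) + PowerSeries.C b := by
  set s : PowerSeries F :=
    PowerSeries.C c * (PowerSeries.C z₀ + PowerSeries.X) + PowerSeries.C d with hs
  have hs0 : PowerSeries.constantCoeff s ≠ 0 := by simpa [hs] using hz₀
  -- Solving `s * (x₀ + w) = a(z₀ + Z) + b` for `w`, the constant terms cancel by `hx₀` and `s * w =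
  -- (a - c x₀) Z` remains.
  refine ⟨PowerSeries.X * (PowerSeries.C (a - c * x₀) * s⁻¹), by simp, ?_, ?_⟩
  · simp [hac, hs0]
  · have e : PowerSeries.C x₀ * (PowerSeries.C c * PowerSeries.C z₀ + PowerSeries.C d) =
        PowerSeries.C a * PowerSeries.C z₀ + PowerSeries.C b := by
      simp only [← map_mul, ← map_add, ← hx₀, mul_comm]
    have hinv := PowerSeries.mul_inv_cancel s hs0
    rw [map_sub, map_mul]
    linear_combination e + PowerSeries.X * (PowerSeries.C a - PowerSeries.C c * PowerSeries.C x₀) *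
      hinv + PowerSeries.C x₀ * hs

theorem expand_mobius {F : Type*} [Field F] {a b c d : F} {m : ℕ} {f : Poly₂ F}
    (hf : f.degreeOf 0 ≤ m) {z x : PowerSeries F} (y₀ : F)
    (h : (PowerSeries.C c * z + PowerSeries.C d) * x = PowerSeries.C a * z + PowerSeries.C b) :
    expand z y₀ (mobius a b c d m f) =
      PowerSeries.map Polynomial.C (PowerSeries.C c * z + PowerSeries.C d) ^ m *
        expand x y₀ f := by
  have e (t : F) : algebraMap F (PowerSeries (Polynomial F)) t =
      PowerSeries.C (Polynomial.C t) := by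
    rw [PowerSeries.algebraMap_apply, Polynomial.algebraMap_eq]
  have := congrArg (PowerSeries.map (Polynomial.C (R := F))) h
  simp only [map_mul, map_add, PowerSeries.map_C, ← e] at this ⊢
  exact aeval_mobius_of_mul_eq hf _ this

/-- The generators differ by powers of `cz + d`, which is a unit here because its constant term is
nonzero. -/
theorem span_mobius_map_eq {F : Type*} [Field F] {a b c d : F} {m n : ℕ} {f g : Poly₂ F}
    (hf : f.degreeOf 0 ≤ m) (hg : g.degreeOf 0 ≤ n) {z x : PowerSeries F} (y₀ : F)
    (h : (PowerSeries.C c * z + PowerSeries.C d) * x = PowerSeries.C a * z + PowerSeries.C b)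
    (hu : PowerSeries.constantCoeff (PowerSeries.C c * z + PowerSeries.C d) ≠ 0) :
    (Ideal.span {mobius a b c d m f, mobius a b c d n g}).map (expand z y₀) =
      (Ideal.span {f, g}).map (expand x y₀) := by
  have hunit : IsUnit (PowerSeries.map (Polynomial.C (R := F))
      (PowerSeries.C c * z + PowerSeries.C d)) :=
    (PowerSeries.isUnit_iff_constantCoeff.2 hu.isUnit).map _
  rw [Ideal.map_span, Ideal.map_span, Set.image_pair, Set.image_pair, expand_mobius hf y₀ h,
    expand_mobius hg y₀ h, Ideal.span_insert, Ideal.span_insert,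
    Ideal.span_singleton_mul_left_unit (hunit.pow m),
    Ideal.span_singleton_mul_left_unit (hunit.pow n)]

theorem mem_zeroLocus_span_pair {F : Type*} [Field F] {f g : Poly₂ F} {v : Fin 2 → F} :
    v ∈ MvPolynomial.zeroLocus F (Ideal.span {f, g}) ↔
      MvPolynomial.aeval v f = 0 ∧ MvPolynomial.aeval v g = 0 := by
  rw [MvPolynomial.zeroLocus_span]
  simp

theorem D_zero_zero_mem_dualSpace {F : Type*} [Field F] {I : Ideal (Poly₂ F)} {x₀ y₀ : F}
    (h : ![x₀, y₀] ∈ MvPolynomial.zeroLocus F I) : D F 0 0 ∈ dualSpace I x₀ y₀ := by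
  have h0 : hasse F 0 0 = LinearMap.id := linearMap_ext_X_pow fun a b => by
    simp [hasse_X_pow_mul_X_pow]
  intro p hp
  rw [toEnd_D, h0]
  exact h p hp

end

end Moller

theorem corollary4p14 {F : Type*} [Field F] [IsAlgClosed F]
    (f g : Moller.Poly₂ F) (m n : ℕ)
    (hm : f.degreeOf 0 = m) (hn : g.degreeOf 0 = n)
    (hfg : Moller.IsZeroDimensional (Ideal.span {f, g}))
    (a b c d : F) (hdet : a * d - b * c = 1) (hc : c ≠ 0)
    (hac : ∀ x y : F, ![x, y] ∈ MvPolynomial.zeroLocus F (Ideal.span {f, g}) → c * x ≠ a)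
    (x₀ z₀ y₀ : F) (hz₀ : c * z₀ + d ≠ 0) (hx₀ : x₀ = (a * z₀ + b) / (c * z₀ + d)) :
    (![x₀, y₀] ∈ MvPolynomial.zeroLocus F (Ideal.span {f, g}) ↔
      ![z₀, y₀] ∈ MvPolynomial.zeroLocus F
        (Ideal.span {Moller.mobius a b c d m f, Moller.mobius a b c d n g})) ∧
    (![x₀, y₀] ∈ MvPolynomial.zeroLocus F (Ideal.span {f, g}) →
      ∃ (β : ℕ) (α : ℕ → ℕ),
        Moller.HasMollerIndices (Moller.dualSpace (Ideal.span {f, g}) x₀ y₀) β α ∧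
        Moller.HasMollerIndices
          (Moller.dualSpace
            (Ideal.span {Moller.mobius a b c d m f, Moller.mobius a b c d n g}) z₀ y₀) β α) := by
  open Moller in
  have hx : (c * z₀ + d) * x₀ = a * z₀ + b := by rw [hx₀]; field_simp
  -- This makes `a - c x₀` nonzero, which serves both as the nonvanishing of the linear coefficient
  -- of `w` and as the nonvanishing of the denominator of the inverse map at `x₀`.
  have hprod : (a - c * x₀) * (c * z₀ + d) = 1 := by linear_combination hdet - c * hx
  have hne : a - c * x₀ ≠ 0 := left_ne_zero_of_mul_eq_one hprod
  refine ⟨?_, fun hmem => ?_⟩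
  · rw [mem_zeroLocus_span_pair, mem_zeroLocus_span_pair,
      aeval_mobius_of_mul_eq hm.le y₀ hx, aeval_mobius_of_mul_eq hn.le y₀ hx]
    simp [hz₀]
  · obtain ⟨w, hw0, hw1, hw⟩ := exists_mobius_series hz₀ hx hne
    -- The inverse map is `x ↦ (d x - b) / (-c x + a)`, expanded at `x₀` with value `z₀`.
    obtain ⟨v, hv0, hv1, hv⟩ := exists_mobius_series (a := d) (b := -b) (c := -c) (d := a)
      (x₀ := z₀) (z₀ := x₀) (fun h => hne (by linear_combination h))
      (by linear_combination -hx) (fun h => hz₀ (by linear_combination h))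
    simp only [map_neg] at hv
    have hT := isTriangular_transport hw0 hw1
    have hT' := isTriangular_transport hv0 hv1
    set V := dualSpace (Ideal.span {f, g}) x₀ y₀
    set W := dualSpace (Ideal.span {mobius a b c d m f, mobius a b c d n g}) z₀ y₀
    have hWV : ∀ φ ∈ W, transport w φ ∈ V := fun φ hφ => by
      refine transport_mem_dualSpace hw0 ?_ hφ
      rw [← Ideal.map_le_iff_le_comap, taylor,
        span_mobius_map_eq hm.le hn.le y₀ hw (by simpa using hz₀)]
    have hVW : ∀ φ ∈ V, transport v φ ∈ W := fun φ hφ => by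
      refine transport_mem_dualSpace hv0 ?_ hφ
      -- The same identity of ideals, now with `x = x₀ + Z` as the parameter and `z = z₀ + v`; the
      -- relation for the inverse map rearranges to the original one.
      rw [← Ideal.map_le_iff_le_comap, taylor, span_mobius_map_eq hm.le hn.le y₀
        (x := PowerSeries.C x₀ + PowerSeries.X) (by linear_combination -hv)
        (by simpa [hv0] using hz₀)]
    have hV : IsClosedSubspace V := ⟨finite_dualSpace hfg x₀ y₀, fun φ hφ =>
      ⟨antiX_mem_dualSpace hφ, antiY_mem_dualSpace hφ⟩⟩
    have hW : IsClosedSubspace W := by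
      refine ⟨?_, fun φ hφ => ⟨antiX_mem_dualSpace hφ, antiY_mem_dualSpace hφ⟩⟩
      have := hV.1
      -- Finite-dimensionality of `W` is inherited from `V` through the injective `transport w`, so
      -- zero-dimensionality of `⟨f̂, ĝ⟩` need not be established.
      exact Module.Finite.of_injective ((transport w).restrict hWV)
        fun φ ψ h => Subtype.ext (hT.injective (congrArg Subtype.val h))
    obtain ⟨β, α, h⟩ := exists_hasMollerIndices hV (D_zero_zero_mem_dualSpace hmem)
    exact ⟨β, α, h, h.congr hT' hT hW hVW hWV⟩
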